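/- **Theorem (Compactness and lower semicontinuity).** Let $X=Y^*$ be the dual of a separable (real) Banach space $Y$, with its dual norm $\|\cdot\|$ and closed unit ball $B_X$, and let $d^*$ be any metric on $B_X$ inducing the restriction to $B_X$ of the weak* topology of $X$. Let $\mathrm{dist}^*_{\mathscr H}$ be the Hausdorff distance between nonempty subsets of the metric space $(B_X,d^*)$, and let $\mathscr H^1$ be the one-dimensional Hausdorff measure on $X$ relative to the norm. The words compact, closed and connected refer to the norm topology. Assume that (A) $(C_n)_n$ is a sequence of nonempty compact connected subsets of $B_X$; (B) $\mathrm{dist}^*_{\mathscr H}(C_n,C)\to 0$ for some nonempty closed subset $C$ of $B_X$; (C) $w:B_X\to(0,+\infty]$ is weakly* lower semicontinuous and $\sup_n\int_{C_n}w\,d\mathscr H^1<\infty$. Then (D) $C$ is compact and connected; (E) $\int_C w\,d\mathscr H^1\le\liminf_n\int_{C_n}w\,d\mathscr H^1$; (F) for every set $F$, if $F\subset C_n$ for every $n$, then $F\subset C$. -/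

import Mathlib

open Filter Topology MeasureTheory
open scoped ENNReal

/-- The closed unit ball of the dual of `Y`, as a subset of the dual with its weak* topology.
Its coercion to a type carries the subspace topology of the weak* topology. -/
def weakStarBall (Y : Type*) [NormedAddCommGroup Y] [NormedSpace ℝ Y] : Set (WeakDual ℝ Y) :=
  WeakDual.toStrongDual ⁻¹' Metric.closedBall (0 : StrongDual ℝ Y) 1

/-- The trace on the unit ball of a set `A` of functionals, seen as a subset of the space
`weakStarBall Y`. -/
def weakStarTrace {Y : Type*} [NormedAddCommGroup Y] [NormedSpace ℝ Y]
    (A : Set (StrongDual ℝ Y)) : Set (weakStarBall Y) :=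
  {x | WeakDual.toStrongDual (x : WeakDual ℝ Y) ∈ A}

/-- The metric `d` on the unit ball of the dual induces the weak* topology of the ball. -/
def IsWeakStarCompatible {Y : Type*} [NormedAddCommGroup Y] [NormedSpace ℝ Y]
    (d : MetricSpace (weakStarBall Y)) : Prop :=
  d.toUniformSpace.toTopologicalSpace = (instTopologicalSpaceSubtype : TopologicalSpace (weakStarBall Y))

/-- The Hausdorff distance, with respect to the metric `d` on the unit ball of the dual, of two
sets of functionals contained in that ball. -/
noncomputable def weakStarHausdorffDist {Y : Type*} [NormedAddCommGroup Y] [NormedSpace ℝ Y]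
    (d : MetricSpace (weakStarBall Y)) (A₁ A₂ : Set (StrongDual ℝ Y)) : ℝ :=
  @Metric.hausdorffDist (weakStarBall Y) d.toPseudoMetricSpace
    (weakStarTrace A₁) (weakStarTrace A₂)

/-- The weighted length of `A`: the integral of `w` over `A` with respect to the one dimensional
Hausdorff measure of the norm metric. -/
noncomputable def weightedLength {Y : Type*} [NormedAddCommGroup Y] [NormedSpace ℝ Y]
    (w : StrongDual ℝ Y → ℝ≥0∞) (A : Set (StrongDual ℝ Y)) : ℝ≥0∞ :=
  ∫⁻ x in A, w x ∂(Measure.hausdorffMeasure 1 : Measure (StrongDual ℝ Y))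

/-! The weight has a positive minimum on the weak* compact ball, so the lengths of the `Cn n` are
bounded by some `L`. The dual norm is weak* lower semicontinuous, so a finite `r`-separated subset
of `C` is copied by `r`-separated points of some `Cn n`. The disjoint balls of radius `r / 2` about
these points each carry length at least `r / 2`, so the cardinality times `r` is at most `2 * L`.
This packing bound makes `C` totally bounded, hence compact, and of finite length. A splitting of
`C` into two disjoint norm compact pieces would be a weak* separation, inherited by some `Cn n`.

Semicontinuity rests on Gołąb's theorem in every weak* open set
(`WeakStarLowerLimit.hausdorffMeasure_inter_le_liminf`). The length of `C` in such a set is nearly a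
finite sum of diameters of disjoint subcontinua (`exists_disjoint_continua_lt_sum_ediam`), which
have disjoint weak* neighbourhoods. Each diameter is nearly the increment of some `y` in the unit
ball of the predual, and the values of `y` on nearby points of `Cn n` almost fill the corresponding
interval (`WeakStarLowerLimit.eventually_abs_sub_le`). Applied to the superlevel sets of `w`, this
gives the inequality of integrals by the layer cake formula and Fatou's lemma. -/

theorem tsum_measure_le_of_pairwiseDisjoint {α : Type*} [MeasurableSpace α]
    {μ : Measure α} {u : Set (Set α)} {A : Set α}
    (hm : ∀ s ∈ u, MeasurableSet s) (hd : u.PairwiseDisjoint id) (hA : ∀ s ∈ u, s ⊆ A) :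
    ∑' s : u, μ s ≤ μ A :=
  (tsum_meas_le_meas_iUnion_of_disjoint μ (fun s : u => hm s s.2)
    (fun s t hst => hd s.2 t.2 (fun h => hst (Subtype.ext h)))).trans
    (measure_mono (Set.iUnion_subset fun s => hA s s.2))

theorem countable_of_pairwiseDisjoint_of_measure_pos {α : Type*} [MeasurableSpace α]
    {μ : Measure α} {u : Set (Set α)} {A : Set α}
    (hm : ∀ s ∈ u, MeasurableSet s) (hd : u.PairwiseDisjoint id) (hA : ∀ s ∈ u, s ⊆ A)
    (hμA : μ A ≠ ∞) (hpos : ∀ s ∈ u, μ s ≠ 0) : u.Countable := by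
  have h := (ne_top_of_le_ne_top hμA
    (tsum_measure_le_of_pairwiseDisjoint (μ := μ) hm hd hA)).symm
  have h2 := Summable.countable_support_ennreal h.symm
  have h3 : (Function.support fun s : u => μ s) = Set.univ := by
    ext s; simpa using hpos s s.2
  rw [h3] at h2
  exact Set.countable_coe_iff.1 (Set.countable_univ_iff.1 h2)

/-! ### Continua of finite length in metric spaces -/

section Continua

variable {X : Type*} [MetricSpace X]

theorem isCompact_connectedComponentIn {K : Set X} (hK : IsCompact K) (x : X) :
    IsCompact (connectedComponentIn K x) := by
  by_cases hx : x ∈ K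
  · have : CompactSpace K := isCompact_iff_compactSpace.1 hK
    rw [connectedComponentIn_eq_image hx]
    exact isClosed_connectedComponent.isCompact.image continuous_subtype_val
  · rw [connectedComponentIn_eq_empty hx]
    exact isCompact_empty

/-- Boundary bumping: if a connected component of `C ∩ F` stays in the open set `O ⊆ F`, then so does
the whole continuum `C`. -/
theorem subset_of_connectedComponentIn_subset {C F O : Set X} {x : X}
    (hC : IsCompact C) (hconn : IsPreconnected C) (hF : IsClosed F) (hO : IsOpen O) (hOF : O ⊆ F)
    (hx : x ∈ C ∩ F) (hsub : connectedComponentIn (C ∩ F) x ⊆ O) : C ⊆ O := by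
  have hK : IsCompact (C ∩ F) := hC.inter_right hF
  have : CompactSpace (C ∩ F : Set X) := isCompact_iff_compactSpace.1 hK
  rw [connectedComponentIn_eq_image hx, connectedComponent_eq_iInter_isClopen] at hsub
  have hdir : Directed (· ⊇ ·)
      (fun s : {s : Set (C ∩ F : Set X) // IsClopen s ∧ ⟨x, hx⟩ ∈ s} => (s : Set (C ∩ F : Set X))) :=
    fun s t => ⟨⟨s.1 ∩ t.1, s.2.1.inter t.2.1, s.2.2, t.2.2⟩,
      Set.inter_subset_left, Set.inter_subset_right⟩
  have : Nonempty {s : Set (C ∩ F : Set X) // IsClopen s ∧ ⟨x, hx⟩ ∈ s} :=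
    ⟨⟨Set.univ, isClopen_univ, trivial⟩⟩
  -- In a compact space a component is the intersection of the clopen sets around it, so one of them
  -- already lies in `O`.
  obtain ⟨⟨Q, hQ, hxQ⟩, hQO⟩ := exists_subset_nhds_of_isCompact' hdir
    (fun s => s.2.1.1.isCompact) (fun s => s.2.1.1)
    (U := (Subtype.val : (C ∩ F : Set X) → X) ⁻¹' O)
    (fun y hy => (hO.preimage continuous_subtype_val).mem_nhds (hsub ⟨y, hy, rfl⟩))
  change Q ⊆ _ at hQO
  obtain ⟨V, hV, rfl⟩ := isOpen_induced_iff.1 hQ.2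
  have hcl : IsClosed (Subtype.val '' (Subtype.val ⁻¹' V : Set (C ∩ F : Set X))) :=
    (hQ.1.isCompact.image continuous_subtype_val).isClosed
  rw [Subtype.image_preimage_coe] at hcl
  have hVO : ∀ y ∈ C ∩ F, y ∈ V → y ∈ O := fun y hy hyV => @hQO ⟨y, hy⟩ hyV
  have hcov : C ⊆ (V ∩ O) ∪ (C ∩ F ∩ V)ᶜ := by
    intro y hy
    by_cases h : y ∈ C ∩ F ∩ V
    · exact Or.inl ⟨h.2, hVO y h.1 h.2⟩
    · exact Or.inr h
  intro y hy
  by_contra hyO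
  obtain ⟨z, hz, hz1, hz2⟩ := hconn _ _ (hV.inter hO) hcl.isOpen_compl hcov
    ⟨x, hx.1, hxQ, hVO x hx hxQ⟩ ⟨y, hy, fun h => hyO (hVO y h.1 h.2)⟩
  exact hz2 ⟨⟨hz, hOF hz1.2⟩, hz1.1⟩

/-- By boundary bumping, the component of `x` in `C ∩ closedBall x r` leaves the open ball, so its
diameter is at least `r`. -/
theorem exists_continuum_mem {C O : Set X} (hC : IsCompact C) (hconn : IsPreconnected C)
    (hnt : C.Nontrivial) (hO : IsOpen O) {x : X} (hx : x ∈ C ∩ O) {δ : ℝ} (hδ : 0 < δ) :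
    ∃ S ⊆ C ∩ O, x ∈ S ∧ IsCompact S ∧ IsConnected S ∧ 0 < Metric.diam S ∧
      Metric.diam S ≤ δ := by
  obtain ⟨z, hz, hzx⟩ := hnt.exists_ne x
  obtain ⟨r₀, hr₀, hb⟩ := Metric.nhds_basis_closedBall.mem_iff.1 (hO.mem_nhds hx.2)
  obtain ⟨r, hr, hr1⟩ : ∃ r > 0, r ≤ r₀ ∧ r ≤ δ / 2 ∧ r ≤ dist z x :=
    ⟨min r₀ (min (δ / 2) (dist z x)),
      lt_min hr₀ (lt_min (half_pos hδ) (dist_pos.2 hzx)), by simp⟩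
  have hxm : x ∈ C ∩ Metric.closedBall x r := ⟨hx.1, Metric.mem_closedBall_self hr.le⟩
  have hsub := connectedComponentIn_subset (C ∩ Metric.closedBall x r) x
  have hcomp : IsCompact (connectedComponentIn (C ∩ Metric.closedBall x r) x) :=
    isCompact_connectedComponentIn (hC.inter_right Metric.isClosed_closedBall) x
  refine ⟨connectedComponentIn (C ∩ Metric.closedBall x r) x, fun y hy => ⟨(hsub hy).1,
    hb (Metric.closedBall_subset_closedBall hr1.1 (hsub hy).2)⟩, mem_connectedComponentIn hxm,
    hcomp, isConnected_connectedComponentIn_iff.2 hxm, ?_, ?_⟩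
  · obtain ⟨y, hy, hyr⟩ : ∃ y ∈ connectedComponentIn (C ∩ Metric.closedBall x r) x,
        y ∉ Metric.ball x r := by
      by_contra! h
      have := subset_of_connectedComponentIn_subset hC hconn Metric.isClosed_closedBall
        Metric.isOpen_ball Metric.ball_subset_closedBall hxm h hz
      exact absurd (Metric.mem_ball.1 this) (not_lt.2 hr1.2.2)
    have h1 := Metric.dist_le_diam_of_mem hcomp.isBounded hy (mem_connectedComponentIn hxm)
    have h2 : r ≤ dist y x := not_lt.1 hyr
    linarith
  · refine (Metric.diam_mono (hsub.trans Set.inter_subset_right)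
      Metric.isBounded_closedBall).trans ?_
    have := Metric.diam_closedBall (x := x) hr.le
    linarith [hr1.2.1]

variable [MeasurableSpace X] [BorelSpace X]

/-- The distance to `x` is 1-Lipschitz and, by connectedness, takes on `C` all values in `[0, r)`.
-/
theorem IsPreconnected.ofReal_le_hausdorffMeasure_inter_ball {C : Set X} (hC : IsPreconnected C)
    {x z : X} (hx : x ∈ C) (hz : z ∈ C) {r : ℝ} (hr : r ≤ dist z x) :
    ENNReal.ofReal r ≤ Measure.hausdorffMeasure 1 (C ∩ Metric.ball x r) := by
  have hlip : LipschitzWith 1 (fun p => dist p x) := LipschitzWith.dist_left x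
  have hsub : Set.Ico 0 r ⊆ (fun p => dist p x) '' (C ∩ Metric.ball x r) := by
    intro t ht
    obtain ⟨p, hp, rfl⟩ := hC.intermediate_value hx hz hlip.continuous.continuousOn
      (show t ∈ Set.Icc (dist x x) (dist z x) from ⟨by simpa using ht.1, ht.2.le.trans hr⟩)
    exact ⟨p, ⟨hp, ht.2⟩, rfl⟩
  calc ENNReal.ofReal r = volume (Set.Ico 0 r) := by simp
    _ ≤ volume ((fun p => dist p x) '' (C ∩ Metric.ball x r)) := measure_mono hsub
    _ = Measure.hausdorffMeasure 1 ((fun p => dist p x) '' (C ∩ Metric.ball x r)) := by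
        rw [hausdorffMeasure_real]
    _ ≤ _ := by simpa using hlip.hausdorffMeasure_image_le zero_le_one (C ∩ Metric.ball x r)

theorem IsPreconnected.ediam_le_hausdorffMeasure {C : Set X} (hC : IsPreconnected C) :
    Metric.ediam C ≤ Measure.hausdorffMeasure 1 C := by
  refine Metric.ediam_le fun x hx y hy => ?_
  rw [edist_dist]
  exact (hC.ofReal_le_hausdorffMeasure_inter_ball hy hx le_rfl).trans
    (measure_mono Set.inter_subset_left)

/-- A disjoint Vitali family of small continua has finite total diameter. Finitely many members are
kept as they are, at cost at most `c`; the others, of total diameter below `ε`, are thickened by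
twice their diameter, which multiplies diameters by at most 5. -/
theorem exists_countable_cover_of_sum_ediam_le {C O : Set X} (hC : IsCompact C)
    (hconn : IsPreconnected C) (hfin : Measure.hausdorffMeasure 1 C ≠ ∞) (hnt : C.Nontrivial)
    (hO : IsOpen O) {c ε : ℝ≥0∞} (hε : 0 < ε)
    (hc : ∀ v : Finset (Set X), (∀ S ∈ v, IsCompact S ∧ IsConnected S ∧ S ⊆ C ∩ O) →
      (v : Set (Set X)).PairwiseDisjoint id → ∑ S ∈ v, Metric.ediam S ≤ c)
    {δ : ℝ} (hδ : 0 < δ) :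
    ∃ (u : Set (Set X)) (t : u → Set X), u.Countable ∧ C ∩ O ⊆ ⋃ i, t i ∧
      (∀ i, Metric.ediam (t i) ≤ ENNReal.ofReal (5 * δ)) ∧
      ∑' i, Metric.ediam (t i) ≤ c + 5 * ε := by
  classical
  set F : Set (Set X) := {S | S ⊆ C ∩ O ∧ IsCompact S ∧ IsConnected S ∧ 0 < Metric.diam S ∧
      Metric.diam S ≤ δ} with hF
  obtain ⟨u, huF, hdisj, hcov⟩ := Vitali.exists_disjoint_subfamily_covering_enlargement
    (fun S : Set X => S) F Metric.diam 2 one_lt_two (fun S hS => hS.2.2.2.1.le) δ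
    (fun S hS => hS.2.2.2.2) (fun S hS => hS.2.2.1.nonempty)
  have hediam : ∀ S ∈ u, Metric.ediam S = ENNReal.ofReal (Metric.diam S) := fun S hS =>
    (ENNReal.ofReal_toReal (huF hS).2.1.isBounded.ediam_ne_top).symm
  have hle : ∀ S ∈ u, Metric.ediam S ≤ Measure.hausdorffMeasure 1 S := fun S hS =>
    (huF hS).2.2.1.isPreconnected.ediam_le_hausdorffMeasure
  have hmeas : ∀ S ∈ u, MeasurableSet S := fun S hS => (huF hS).2.1.isClosed.measurableSet
  have hsubC : ∀ S ∈ u, S ⊆ C := fun S hS => (huF hS).1.trans Set.inter_subset_left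
  have hcount : u.Countable := countable_of_pairwiseDisjoint_of_measure_pos hmeas hdisj hsubC hfin
    (fun S hS h => by
      have := hle S hS
      rw [h, hediam S hS, nonpos_iff_eq_zero, ENNReal.ofReal_eq_zero] at this
      exact absurd (huF hS).2.2.2.1 (not_lt.2 this))
  have hsum : ∑' S : u, Metric.ediam (S : Set X) ≠ ∞ :=
    ne_top_of_le_ne_top hfin ((ENNReal.tsum_le_tsum fun S : u => hle S S.2).trans
      (tsum_measure_le_of_pairwiseDisjoint (μ := Measure.hausdorffMeasure 1) hmeas hdisj hsubC))
  obtain ⟨s, hs⟩ := ((ENNReal.tendsto_tsum_compl_atTop_zero hsum).eventually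
    (gt_mem_nhds hε)).exists
  refine ⟨u, fun S => if S ∈ s then S else Metric.cthickening (2 * Metric.diam (S : Set X)) S,
    hcount, ?_, ?_, ?_⟩
  · intro x hx
    by_cases hxs : ∃ S ∈ s, x ∈ (S : Set X)
    · obtain ⟨S, hS, hxS⟩ := hxs
      exact Set.mem_iUnion.2 ⟨S, by simpa [hS] using hxS⟩
    -- A small continuum through `x` can avoid the closed union of the kept sets, so the Vitali set
    -- that it meets is a thickened one.
    · have hcl : IsClosed (⋃ S : u, ⋃ (_ : S ∈ s), (S : Set X)) :=
        isClosed_biUnion_finset (s := s) (f := fun S : u => (S : Set X))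
          fun S _ => (huF S.2).2.1.isClosed
      obtain ⟨K, hK, hxK, hK2⟩ := exists_continuum_mem hC hconn hnt (hO.inter hcl.isOpen_compl)
        (x := x) ⟨hx.1, hx.2, by simpa using hxs⟩ hδ
      obtain ⟨S, hSu, ⟨z, hzK, hzS⟩, hKS⟩ := hcov K
        ⟨hK.trans (Set.inter_subset_inter_right _ Set.inter_subset_left), hK2⟩
      have hSs : (⟨S, hSu⟩ : u) ∉ s := fun h =>
        (hK hzK).2.2 (Set.mem_iUnion₂.2 ⟨_, h, hzS⟩)
      refine Set.mem_iUnion.2 ⟨⟨S, hSu⟩, ?_⟩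
      simp only [hSs, if_false]
      exact Metric.mem_cthickening_of_dist_le x z _ _ hzS
        ((Metric.dist_le_diam_of_mem hK2.1.isBounded hxK hzK).trans hKS)
  all_goals
    have hthick : ∀ S : u, Metric.ediam (if S ∈ s then (S : Set X) else
        Metric.cthickening (2 * Metric.diam (S : Set X)) S) ≤
        if S ∈ s then Metric.ediam (S : Set X) else 5 * Metric.ediam (S : Set X) := by
      intro S
      split_ifs
      · exact le_rfl
      · have h := Metric.ediam_cthickening_le (s := (S : Set X))
          (Real.toNNReal (2 * Metric.diam (S : Set X)))
        rw [Real.coe_toNNReal _ (by positivity)] at h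
        refine h.trans (le_of_eq ?_)
        change _ + 2 * ENNReal.ofReal _ = _
        rw [ENNReal.ofReal_mul zero_le_two, ← hediam S S.2, ENNReal.ofReal_ofNat]
        ring
  · intro S
    refine (hthick S).trans ?_
    have h5 : 5 * Metric.ediam (S : Set X) ≤ ENNReal.ofReal (5 * δ) := by
      rw [hediam S S.2, ENNReal.ofReal_mul (by norm_num), ENNReal.ofReal_ofNat]
      gcongr
      exact (huF S.2).2.2.2.2
    split_ifs
    · exact le_trans (le_mul_of_one_le_left' (by norm_num)) h5
    · exact h5
  · refine (ENNReal.tsum_le_tsum hthick).trans ?_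
    set f : u → ℝ≥0∞ := fun S => if S ∈ s then Metric.ediam (S : Set X) else
      5 * Metric.ediam (S : Set X) with hf
    have hsplit : ∑' S, f S = ∑ S ∈ s, f S + ∑' S : {S // S ∉ s}, f S := by
      rw [← Finset.tsum_subtype]
      exact (Summable.tsum_add_tsum_compl (s := (s : Set u)) ENNReal.summable
        ENNReal.summable).symm
    rw [hsplit]
    refine add_le_add ?_ ?_
    · rw [Finset.sum_congr rfl fun S hS => if_pos hS]
      have := hc (s.map (Function.Embedding.subtype _))
        (fun S hS => by
          obtain ⟨T, -, rfl⟩ := Finset.mem_map.1 hS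
          exact ⟨(huF T.2).2.1, (huF T.2).2.2.1, (huF T.2).1⟩)
        (hdisj.subset fun S hS => by
          obtain ⟨T, -, rfl⟩ := Finset.mem_map.1 hS
          exact T.2)
      simpa using this
    · calc _ = ∑' S : {S : u // S ∉ s}, 5 * Metric.ediam ((S : u) : Set X) :=
            tsum_congr fun S => if_neg S.2
        _ = 5 * ∑' S : {S : u // S ∉ s}, Metric.ediam ((S : u) : Set X) := ENNReal.tsum_mul_left
        _ ≤ 5 * ε := by gcongr

/-- The length of an open piece of a continuum of finite length is approximated from below by the sum
of the diameters of finitely many disjoint subcontinua of the piece. -/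
theorem exists_disjoint_continua_lt_sum_ediam {C O : Set X} (hC : IsCompact C)
    (hconn : IsPreconnected C) (hfin : Measure.hausdorffMeasure 1 C ≠ ∞) (hO : IsOpen O)
    {c : ℝ≥0∞} (hc : c < Measure.hausdorffMeasure 1 (C ∩ O)) :
    ∃ v : Finset (Set X), (∀ S ∈ v, IsCompact S ∧ IsConnected S ∧ S ⊆ C ∩ O) ∧
      (v : Set (Set X)).PairwiseDisjoint id ∧ c < ∑ S ∈ v, Metric.ediam S := by
  by_contra! hcon
  have hnt : C.Nontrivial := by
    by_contra h
    rw [Set.not_nontrivial_iff] at h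
    have : Measure.hausdorffMeasure 1 (C ∩ O) ≤ (0 : ℝ≥0∞) := by
      have := Measure.nullSingletonClass_hausdorff X one_pos
      exact ((h.anti Set.inter_subset_left).measure_zero _).le
    exact absurd hc (not_lt.2 (this.trans zero_le))
  refine absurd hc (not_lt.2 (ENNReal.le_of_forall_pos_le_add fun ε hε _ => ?_))
  -- Covers with mesh tending to 0 bound the Hausdorff measure by `c + ε`; the choice `ε / 5`
  -- absorbs the Vitali factor.
  choose u t hu hcov hdiam hsum using fun n : ℕ =>
    exists_countable_cover_of_sum_ediam_le hC hconn hfin hnt hO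
    (ε := (ε / 5 : NNReal)) (by exact_mod_cast div_pos hε (by norm_num)) hcon
    (Nat.one_div_pos_of_nat (n := n) (α := ℝ))
  have : ∀ n, Countable (u n) := fun n => (hu n).to_subtype
  have hr : Tendsto (fun n : ℕ => ENNReal.ofReal (5 * (1 / ((n : ℝ) + 1)))) atTop (𝓝 0) := by
    have := ENNReal.tendsto_ofReal (tendsto_one_div_add_atTop_nhds_zero_nat (𝕜 := ℝ).const_mul 5)
    simpa using this
  refine (Measure.hausdorffMeasure_le_liminf_tsum 1 _ _ hr t (Eventually.of_forall hdiam)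
    (Eventually.of_forall hcov)).trans ?_
  simp only [ENNReal.rpow_one]
  have h5 : (5 : ℝ≥0∞) * ((ε / 5 : NNReal) : ℝ≥0∞) = ε := by
    have : (5 : NNReal) * (ε / 5) = ε := by field_simp
    exact_mod_cast this
  rw [← h5]
  exact (liminf_le_liminf (Eventually.of_forall hsum)).trans (by simp)

end Continua

/-! ### Hausdorff convergence and packing bounds -/

section Packing

variable {X : Type*} [MetricSpace X]

theorem eventually_nonempty_inter_of_tendsto_hausdorffDist {Z : Type*} [PseudoMetricSpace Z]
    [CompactSpace Z] {A : ℕ → Set Z} {B : Set Z} (hA : ∀ n, (A n).Nonempty)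
    (h : Tendsto (fun n => Metric.hausdorffDist (A n) B) atTop (𝓝 0)) {G : Set Z} (hG : IsOpen G)
    (hBG : (B ∩ G).Nonempty) : ∀ᶠ n in atTop, (A n ∩ G).Nonempty := by
  obtain ⟨x, hxB, hxG⟩ := hBG
  obtain ⟨ε, hε, hb⟩ := Metric.isOpen_iff.1 hG x hxG
  filter_upwards [h.eventually (gt_mem_nhds hε)] with n hn
  obtain ⟨y, hy, hxy⟩ := Metric.exists_dist_lt_of_hausdorffDist_lt' hxB hn
    -- The real Hausdorff distance is 0 when the extended one is infinite; nonemptiness and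
    -- boundedness exclude this.
    (Metric.hausdorffEDist_ne_top_of_nonempty_of_bounded (hA n) ⟨x, hxB⟩
      (isCompact_univ.isBounded.subset (Set.subset_univ _))
      (isCompact_univ.isBounded.subset (Set.subset_univ _)))
  exact ⟨y, hy, hb hxy⟩

theorem eventually_subset_of_tendsto_hausdorffDist {Z : Type*} [PseudoMetricSpace Z]
    [CompactSpace Z] {A : ℕ → Set Z} {B : Set Z} (hA : ∀ n, (A n).Nonempty) (hBne : B.Nonempty)
    (h : Tendsto (fun n => Metric.hausdorffDist (A n) B) atTop (𝓝 0)) (hB : IsCompact B)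
    {G : Set Z} (hG : IsOpen G) (hBG : B ⊆ G) : ∀ᶠ n in atTop, A n ⊆ G := by
  obtain ⟨ε, hε, hb⟩ := hB.exists_thickening_subset_open hG hBG
  filter_upwards [h.eventually (gt_mem_nhds hε)] with n hn x hx
  obtain ⟨y, hy, hxy⟩ := Metric.exists_dist_lt_of_hausdorffDist_lt hx hn
    (Metric.hausdorffEDist_ne_top_of_nonempty_of_bounded (hA n) hBne
      (isCompact_univ.isBounded.subset (Set.subset_univ _))
      (isCompact_univ.isBounded.subset (Set.subset_univ _)))
  exact hb (Metric.mem_thickening_iff.2 ⟨y, hy, hxy⟩)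

theorem packingNumber_ne_top_of_card_mul_le {C : Set X} {M : ℝ≥0∞} (hM : M ≠ ∞) {r : NNReal}
    (hr : 0 < r)
    (h : ∀ t : Finset X, (t : Set X) ⊆ C → Metric.IsSeparated r (t : Set X) → 1 < t.card →
      t.card * (r : ℝ≥0∞) ≤ M) : Metric.packingNumber r C ≠ ⊤ := by
  obtain ⟨k, hk⟩ := ENNReal.exists_nat_mul_gt (b := M) (a := r) (by exact_mod_cast hr.ne') hM
  -- With `k + 2` in place of `k`, the extracted finite set has more than one point, as `h`
  -- requires.
  refine ne_top_of_le_ne_top (ENat.natCast_ne_top (k + 2)) ?_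
  refine iSup_le fun N => iSup_le fun hN => iSup_le fun hsep => ?_
  by_contra! hlt
  obtain ⟨t, htN, htc⟩ := Set.exists_subset_encard_eq hlt.le
  have hfin : t.Finite := Set.finite_of_encard_eq_coe htc
  have hcard : hfin.toFinset.card = k + 2 := by
    rw [hfin.encard_eq_coe_toFinset_card] at htc
    exact_mod_cast htc
  have h1 := h hfin.toFinset (by simpa using htN.trans hN) (by simpa using hsep.subset htN)
    (by omega)
  rw [hcard] at h1
  refine absurd (hk.trans_le (le_trans ?_ h1)) (lt_irrefl _)
  gcongr
  omega

theorem totallyBounded_of_card_mul_le {C : Set X} {M : ℝ≥0∞} (hM : M ≠ ∞)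
    (h : ∀ (r : NNReal) (t : Finset X), (t : Set X) ⊆ C → Metric.IsSeparated r (t : Set X) →
      1 < t.card → t.card * (r : ℝ≥0∞) ≤ M) : TotallyBounded C := by
  refine Metric.totallyBounded_iff.2 fun ε hε => ?_
  have hr : 0 < Real.toNNReal (ε / 2) := by simpa using hε
  have hp := packingNumber_ne_top_of_card_mul_le hM hr (h _)
  obtain ⟨N, -, hNfin, hN, -⟩ := Metric.exists_set_encard_eq_coveringNumber
    (ne_top_of_le_ne_top hp (Metric.coveringNumber_le_packingNumber _ _))
  refine ⟨N, hNfin, fun x hx => ?_⟩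
  obtain ⟨y, hy, hxy⟩ := hN hx
  refine Set.mem_iUnion₂.2 ⟨y, hy, ?_⟩
  have h2 : edist x y ≤ ENNReal.ofReal (ε / 2) := hxy
  rw [edist_dist, ENNReal.ofReal_le_ofReal_iff (by positivity)] at h2
  exact Metric.mem_ball.2 (by linarith)

variable [MeasurableSpace X] [BorelSpace X]

/-- A minimal cover by balls of radius `r` has at most as many members as a maximal `r`-separated
set, each of diameter at most `2 * r`. The total stays below `2 * (M + 1)` as `r` tends to 0; the 1
pays for packings with at most one point. -/
theorem hausdorffMeasure_ne_top_of_card_mul_le {C : Set X} {M : ℝ≥0∞} (hM : M ≠ ∞)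
    (h : ∀ (r : NNReal) (t : Finset X), (t : Set X) ⊆ C → Metric.IsSeparated r (t : Set X) →
      1 < t.card → t.card * (r : ℝ≥0∞) ≤ M) : Measure.hausdorffMeasure 1 C ≠ ∞ := by
  set r : ℕ → NNReal := fun n => 1 / ((n : NNReal) + 1) with hr
  have hrpos : ∀ n, 0 < r n := fun n => by positivity
  have hr1 : ∀ n, r n ≤ 1 := fun n => by
    simp only [hr]
    exact div_le_one_of_le₀ (by simp) (by positivity)
  have hp := fun n => packingNumber_ne_top_of_card_mul_le hM (hrpos n) (h _)
  have key : ∀ n, ∃ N : Finset X, Metric.IsCover (r n) C (N : Set X) ∧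
      N.card * (r n : ℝ≥0∞) ≤ M + 1 := by
    intro n
    obtain ⟨N, hNC, hNfin, hsep, henc⟩ := Metric.exists_set_encard_eq_packingNumber (hp n)
    obtain ⟨N', hN'C, hN'fin, hN', henc'⟩ := Metric.exists_set_encard_eq_coveringNumber
      (ne_top_of_le_ne_top (hp n) (Metric.coveringNumber_le_packingNumber _ _))
    refine ⟨hN'fin.toFinset, by simpa using hN', ?_⟩
    have hle : hN'fin.toFinset.card ≤ hNfin.toFinset.card := by
      have := Metric.coveringNumber_le_packingNumber (r n) C
      rw [← henc, ← henc', hNfin.encard_eq_coe_toFinset_card,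
        hN'fin.encard_eq_coe_toFinset_card] at this
      exact_mod_cast this
    have hle2 : (hN'fin.toFinset.card : ℝ≥0∞) * r n ≤ hNfin.toFinset.card * r n := by gcongr
    refine hle2.trans ?_
    rcases lt_or_ge 1 hNfin.toFinset.card with h1 | h1
    · exact (h (r n) hNfin.toFinset (by simpa using hNC) (by simpa using hsep) h1).trans
        le_self_add
    · refine le_trans ?_ le_add_self
      exact mul_le_one' (by exact_mod_cast h1) (by exact_mod_cast hr1 n)
  choose N hcov hcard using key
  have hlim : Tendsto (fun n => 2 * (r n : ℝ≥0∞)) atTop (𝓝 0) := by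
    have h1 : Tendsto r atTop (𝓝 0) := by
      rw [← NNReal.tendsto_coe]
      simpa [hr] using tendsto_one_div_add_atTop_nhds_zero_nat (𝕜 := ℝ)
    have := ENNReal.Tendsto.const_mul (a := 2) (ENNReal.tendsto_coe.2 h1) (Or.inr (by simp))
    simpa using this
  have hdiam : ∀ n, ∀ x : N n, Metric.ediam (Metric.closedEBall (x : X) (r n)) ≤ 2 * r n :=
    fun n x => Metric.ediam_closedEBall_le
  refine ne_top_of_le_ne_top (b := 2 * (M + 1)) (by finiteness) ?_
  refine (Measure.hausdorffMeasure_le_liminf_tsum 1 C _ hlim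
    (fun n (x : N n) => Metric.closedEBall (x : X) (r n)) (Eventually.of_forall hdiam)
    (Eventually.of_forall fun n x hx => ?_)).trans ?_
  · obtain ⟨y, hy, hxy⟩ := hcov n hx
    exact Set.mem_iUnion.2 ⟨⟨y, hy⟩, hxy⟩
  · simp only [ENNReal.rpow_one]
    refine (liminf_le_liminf (Eventually.of_forall fun n => ?_)).trans
      (liminf_const (2 * (M + 1))).le
    refine (ENNReal.tsum_le_tsum (hdiam n)).trans ?_
    rw [tsum_fintype, Finset.sum_const, Finset.card_univ, Fintype.card_coe, nsmul_eq_mul]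
    calc _ = 2 * ((N n).card * (r n : ℝ≥0∞)) := by ring
      _ ≤ _ := by gcongr; exact hcard n

/-- The balls of radius `r / 2` are disjoint, and a second point outside each of them forces length
`r / 2` inside. -/
theorem IsPreconnected.card_mul_le_hausdorffMeasure {D : Set X} (hD : IsPreconnected D)
    {ι : Type*} {t : Finset ι} {f : ι → X} {r : ℝ} (hf : ∀ i ∈ t, f i ∈ D)
    (hsep : ∀ i ∈ t, ∀ j ∈ t, i ≠ j → r ≤ dist (f i) (f j)) (hDm : MeasurableSet D)
    (ht : 1 < t.card) : t.card * ENNReal.ofReal (r / 2) ≤ Measure.hausdorffMeasure 1 D := by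
  rcases le_or_gt r 0 with hr | hr
  · simp [ENNReal.ofReal_of_nonpos (show r / 2 ≤ 0 by linarith)]
  have hball : ∀ i ∈ t, ENNReal.ofReal (r / 2) ≤
      Measure.hausdorffMeasure 1 (D ∩ Metric.ball (f i) (r / 2)) := by
    intro i hi
    obtain ⟨j, hj, hji⟩ := Finset.exists_mem_ne ht i
    exact hD.ofReal_le_hausdorffMeasure_inter_ball (hf i hi) (hf j hj)
      (by linarith [hsep j hj i hi hji])
  calc t.card * ENNReal.ofReal (r / 2) = ∑ i ∈ t, ENNReal.ofReal (r / 2) := by simp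
    _ ≤ ∑ i ∈ t, Measure.hausdorffMeasure 1 (D ∩ Metric.ball (f i) (r / 2)) :=
        Finset.sum_le_sum hball
    _ = Measure.hausdorffMeasure 1 (⋃ i ∈ t, D ∩ Metric.ball (f i) (r / 2)) := by
        refine (measure_biUnion_finset (fun i hi j hj hij => ?_)
          fun i _ => hDm.inter measurableSet_ball).symm
        refine Disjoint.mono Set.inter_subset_right Set.inter_subset_right
          (Metric.ball_disjoint_ball ?_)
        linarith [hsep i hi j hj hij]
    _ ≤ _ := measure_mono (Set.iUnion₂_subset fun i _ => Set.inter_subset_left)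

end Packing

/-- Lower semicontinuity of the measures of all superlevel sets passes to the integrals. -/
theorem lintegral_le_liminf_lintegral_of_measure_lt_le {α : Type*} [MeasurableSpace α]
    {μ : Measure α} {ν : ℕ → Measure α} {f : α → ℝ≥0∞} (hf : Measurable f)
    (h : ∀ t, μ {x | t < f x} ≤ liminf (fun n => ν n {x | t < f x}) atTop) :
    ∫⁻ x, f x ∂μ ≤ liminf (fun n => ∫⁻ x, f x ∂(ν n)) atTop := by
  -- Truncation at `M` makes the integrand finite, as the layer cake formula for real functions
  -- needs.
  have hlayer : ∀ (M : ℕ) (κ : Measure α), ∫⁻ x, min (f x) M ∂κ =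
      ∫⁻ t in Set.Ioi (0 : ℝ), κ {x | t < (min (f x) M).toReal} := by
    intro M κ
    rw [← lintegral_eq_lintegral_meas_lt κ (Eventually.of_forall fun _ => ENNReal.toReal_nonneg)
      (hf.min measurable_const).ennreal_toReal.aemeasurable]
    refine lintegral_congr fun x => (ENNReal.ofReal_toReal ?_).symm
    exact ne_top_of_le_ne_top (ENNReal.natCast_ne_top M) (min_le_right _ _)
  have hset : ∀ (M : ℕ) (t : ℝ), 0 < t → {x | t < (min (f x) M).toReal} =
      if t < M then {x | ENNReal.ofReal t < f x} else ∅ := by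
    intro M t ht
    ext x
    rw [Set.mem_ofPred_eq, ← ENNReal.ofReal_lt_iff_lt_toReal ht.le
      (ne_top_of_le_ne_top (ENNReal.natCast_ne_top M) (min_le_right _ _)), lt_min_iff,
      ← ENNReal.ofReal_natCast, ENNReal.ofReal_lt_ofReal_iff']
    split_ifs with hM
    · simp [hM, ht.trans hM]
    · simp [hM]
  have htrunc : ∀ M : ℕ, ∫⁻ x, min (f x) M ∂μ ≤ liminf (fun n => ∫⁻ x, f x ∂(ν n)) atTop := by
    intro M
    calc ∫⁻ x, min (f x) M ∂μ
        ≤ ∫⁻ t in Set.Ioi (0 : ℝ),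
            liminf (fun n => ν n {x | t < (min (f x) M).toReal}) atTop := by
          rw [hlayer]
          refine setLIntegral_mono' measurableSet_Ioi fun t ht => ?_
          simp only [hset M t ht]
          split_ifs
          · exact h _
          · simp
      _ ≤ liminf (fun n => ∫⁻ t in Set.Ioi (0 : ℝ), ν n {x | t < (min (f x) M).toReal}) atTop :=
          lintegral_liminf_le fun n => Antitone.measurable fun s t hst =>
            measure_mono fun x hx => lt_of_le_of_lt hst hx
      _ = liminf (fun n => ∫⁻ x, min (f x) M ∂(ν n)) atTop := by simp only [hlayer]
      _ ≤ _ := liminf_le_liminf (Eventually.of_forall fun n =>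
          lintegral_mono fun x => min_le_left _ _)
  have hsup : ∀ x, f x = ⨆ M : ℕ, min (f x) M := by
    intro x
    rw [← inf_iSup_eq, ENNReal.iSup_natCast, inf_top_eq]
  calc ∫⁻ x, f x ∂μ = ∫⁻ x, ⨆ M : ℕ, min (f x) M ∂μ := lintegral_congr hsup
    _ = ⨆ M : ℕ, ∫⁻ x, min (f x) M ∂μ := lintegral_iSup (fun M => hf.min measurable_const)
        fun M N hMN x => min_le_min le_rfl (by exact_mod_cast hMN)
    _ ≤ _ := iSup_le htrunc

/-! ### Norm geometry under weak* approximation -/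

section WeakStar

variable {Y : Type*} [NormedAddCommGroup Y] [NormedSpace ℝ Y]

theorem lipschitzWith_apply_of_norm_le_one {y : Y} (hy : ‖y‖ ≤ 1) :
    LipschitzWith 1 (fun f : StrongDual ℝ Y => f y) := by
  refine LipschitzWith.of_dist_le_mul fun f g => ?_
  rw [dist_eq_norm, dist_eq_norm, ← sub_apply, NNReal.coe_one, one_mul]
  exact (f - g).le_of_opNorm_le_of_le le_rfl hy |>.trans (by simp)

/-- Closed dual balls are weak* closed. This lets separated points be moved within weak*
neighbourhoods. -/
theorem isOpen_weakDual_lt_dist (r : ℝ) : IsOpen {p : WeakDual ℝ Y × WeakDual ℝ Y |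
    r < dist (WeakDual.toStrongDual p.1) (WeakDual.toStrongDual p.2)} := by
  have h := (WeakDual.isClosed_closedBall (0 : StrongDual ℝ Y) r).isOpen_compl.preimage
    (continuous_fst.sub continuous_snd :
      Continuous fun p : WeakDual ℝ Y × WeakDual ℝ Y => p.1 - p.2)
  convert h using 1
  ext p
  simp [dist_eq_norm]

/-- The difference set is weak* compact and misses 0, so its complement is weak* open, hence
contains a norm ball about 0. -/
theorem exists_pos_le_dist_of_disjoint_isCompact {A B : Set (WeakDual ℝ Y)} (hA : IsCompact A)
    (hB : IsCompact B) (hAB : Disjoint A B) : ∃ ρ > 0, ∀ p q : StrongDual ℝ Y,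
      StrongDual.toWeakDual p ∈ A → StrongDual.toWeakDual q ∈ B → ρ ≤ dist p q := by
  have hK : IsCompact ((fun p : WeakDual ℝ Y × WeakDual ℝ Y => p.1 - p.2) '' (A ×ˢ B)) :=
    (hA.prod hB).image (continuous_fst.sub continuous_snd)
  have hopen := hK.isClosed.isOpen_compl.preimage
    (NormedSpace.Dual.toWeakDual_continuous (𝕜 := ℝ) (E := Y))
  obtain ⟨ρ, hρ, hb⟩ := Metric.isOpen_iff.1 hopen 0 (by
    rintro ⟨⟨p, q⟩, ⟨hp, hq⟩, hpq⟩
    have hpq' : p = q := sub_eq_zero.1 (by simpa using hpq)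
    exact Set.disjoint_left.1 hAB hp (hpq' ▸ hq))
  refine ⟨ρ, hρ, fun p q hp hq => ?_⟩
  by_contra! hlt
  refine hb (show p - q ∈ Metric.ball 0 ρ by simpa [dist_eq_norm] using hlt) ?_
  exact ⟨(StrongDual.toWeakDual p, StrongDual.toWeakDual q), ⟨hp, hq⟩, by simp⟩

theorem isCompact_toWeakDual_image {S : Set (StrongDual ℝ Y)} (hS : IsCompact S) :
    IsCompact (StrongDual.toWeakDual '' S) :=
  hS.image NormedSpace.Dual.toWeakDual_continuous

/-- Every weak* neighbourhood of every point of `C` eventually meets `Cn n`. -/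
def WeakStarLowerLimit (Cn : ℕ → Set (StrongDual ℝ Y)) (C : Set (StrongDual ℝ Y)) : Prop :=
  ∀ x ∈ C, ∀ G : Set (WeakDual ℝ Y), IsOpen G → StrongDual.toWeakDual x ∈ G →
    ∀ᶠ n in atTop, ∃ z ∈ Cn n, StrongDual.toWeakDual z ∈ G

variable {Cn : ℕ → Set (StrongDual ℝ Y)} {C : Set (StrongDual ℝ Y)}

theorem WeakStarLowerLimit.eventually_exists_separated (h : WeakStarLowerLimit Cn C)
    {t : Finset (StrongDual ℝ Y)} (ht : (t : Set (StrongDual ℝ Y)) ⊆ C) {r : ℝ}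
    (hsep : ∀ x ∈ t, ∀ y ∈ t, x ≠ y → r < dist x y) :
    ∀ᶠ n in atTop, ∃ f : t → StrongDual ℝ Y, (∀ i, f i ∈ Cn n) ∧
      ∀ i j, i ≠ j → r < dist (f i) (f j) := by
  have hopen : IsOpen {φ : t → WeakDual ℝ Y | ∀ i j, i ≠ j →
      r < dist (WeakDual.toStrongDual (φ i)) (WeakDual.toStrongDual (φ j))} := by
    simp only [Set.ofPred_forall]
    refine isOpen_iInter_of_finite fun i => isOpen_iInter_of_finite fun j =>
      isOpen_iInter_of_finite fun _ => ?_
    have hc : Continuous fun φ : t → WeakDual ℝ Y => (φ i, φ j) :=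
      (continuous_apply i).prodMk (continuous_apply j)
    exact (isOpen_weakDual_lt_dist r).preimage hc
  obtain ⟨U, hU, hsub⟩ := isOpen_pi_iff'.1 hopen (fun i => StrongDual.toWeakDual (i : StrongDual ℝ Y))
    fun i j hij => hsep i i.2 j j.2 fun h => hij (Subtype.ext h)
  have hev : ∀ᶠ n in atTop, ∀ i : t, ∃ z ∈ Cn n, StrongDual.toWeakDual z ∈ U i :=
    eventually_all.2 fun i => h i (ht i.2) (U i) (hU i).1 (hU i).2
  filter_upwards [hev] with n hn
  choose f hf hfU using hn
  exact ⟨f, hf, @hsub (fun i => StrongDual.toWeakDual (f i)) fun i _ => hfU i⟩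

theorem WeakStarLowerLimit.card_mul_le (h : WeakStarLowerLimit Cn C)
    (hcomp : ∀ n, IsCompact (Cn n)) (hconn : ∀ n, IsPreconnected (Cn n)) {L : ℝ≥0∞}
    (hL : ∀ n, Measure.hausdorffMeasure 1 (Cn n) ≤ L) (r : NNReal)
    (t : Finset (StrongDual ℝ Y)) (ht : (t : Set (StrongDual ℝ Y)) ⊆ C)
    (hsep : Metric.IsSeparated r (t : Set (StrongDual ℝ Y))) (hcard : 1 < t.card) :
    t.card * (r : ℝ≥0∞) ≤ 2 * L := by
  obtain ⟨n, f, hf, hfsep⟩ := (h.eventually_exists_separated ht (r := r) (fun x hx y hy hxy => by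
    have : (r : ℝ≥0∞) < edist x y := hsep hx hy hxy
    rw [edist_nndist] at this
    exact_mod_cast this)).exists
  have h1 := (hconn n).card_mul_le_hausdorffMeasure (t := Finset.univ) (f := f) (r := r)
    (fun i _ => hf i) (fun i _ j _ hij => (hfsep i j hij).le) (hcomp n).measurableSet
    (by simpa using hcard)
  have h2 := h1.trans (hL n)
  have h3 : (r : ℝ≥0∞) = 2 * ENNReal.ofReal (r / 2) := by
    rw [← ENNReal.ofReal_ofNat, ← ENNReal.ofReal_mul (by norm_num), mul_div_cancel₀ _ two_ne_zero,
      ENNReal.ofReal_coe_nnreal]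
  rw [h3]
  simp only [Finset.card_univ, Fintype.card_coe] at h2
  calc _ = 2 * (t.card * ENNReal.ofReal (r / 2)) := by ring
    _ ≤ _ := by gcongr

/-- Disjoint norm compact pieces of `C` are weak* compact and have disjoint weak* open
neighbourhoods. Some `Cn n` lies in their union and meets both. -/
theorem isPreconnected_of_eventually_subset (hlow : WeakStarLowerLimit Cn C)
    (hC : IsCompact C) (hconn : ∀ n, IsPreconnected (Cn n))
    (hup : ∀ G : Set (WeakDual ℝ Y), IsOpen G → C ⊆ StrongDual.toWeakDual ⁻¹' G →
      ∀ᶠ n in atTop, Cn n ⊆ StrongDual.toWeakDual ⁻¹' G) : IsPreconnected C := by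
  rw [isPreconnected_closed_iff]
  intro A B hA hB hcov ⟨a, haC, haA⟩ ⟨b, hbC, hbB⟩
  by_contra hne
  have hdisj : Disjoint (StrongDual.toWeakDual '' (C ∩ A)) (StrongDual.toWeakDual '' (C ∩ B)) :=
    (Set.disjoint_image_iff StrongDual.toWeakDual.injective).2 (Set.disjoint_left.2
      fun x hx hx' => hne ⟨x, hx.1, hx.2, hx'.2⟩)
  obtain ⟨U, V, hU, hV, hAU, hBV, hUV⟩ := SeparatedNhds.of_isCompact_isCompact
    (isCompact_toWeakDual_image (hC.inter_right hA))
    (isCompact_toWeakDual_image (hC.inter_right hB)) hdisj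
  have hsub : C ⊆ StrongDual.toWeakDual ⁻¹' (U ∪ V) := fun x hx => (hcov hx).imp
    (fun h => hAU ⟨x, ⟨hx, h⟩, rfl⟩) (fun h => hBV ⟨x, ⟨hx, h⟩, rfl⟩)
  obtain ⟨n, hn, hnU, hnV⟩ := ((hup _ (hU.union hV) hsub).and
    ((hlow a haC U hU (hAU ⟨a, ⟨haC, haA⟩, rfl⟩)).and
      (hlow b hbC V hV (hBV ⟨b, ⟨hbC, hbB⟩, rfl⟩)))).exists
  obtain ⟨z, hz, hzU, hzV⟩ := hconn n _ _ (hU.preimage NormedSpace.Dual.toWeakDual_continuous)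
    (hV.preimage NormedSpace.Dual.toWeakDual_continuous) hn hnU hnV
  exact Set.disjoint_left.1 hUV hzU hzV

/-- Compactness of `S` makes the approximation uniform, for a single evaluation `y`. -/
theorem WeakStarLowerLimit.eventually_forall_exists_near (h : WeakStarLowerLimit Cn C)
    {S : Set (StrongDual ℝ Y)} (hS : IsCompact S) (hSC : S ⊆ C) {W : Set (WeakDual ℝ Y)}
    (hW : IsOpen W) (hSW : S ⊆ StrongDual.toWeakDual ⁻¹' W) (y : Y) {ω : ℝ} (hω : 0 < ω) :
    ∀ᶠ n in atTop, ∀ s ∈ S, ∃ z ∈ Cn n, StrongDual.toWeakDual z ∈ W ∧ |s y - z y| < ω := by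
  have hev : ∀ (s : StrongDual ℝ Y) (δ : ℝ), IsOpen {q : WeakDual ℝ Y | |s y - q y| < δ} :=
    fun s δ => isOpen_lt
      (continuous_const.sub (WeakDual.eval_continuous y)).abs continuous_const
  refine hS.induction_on (p := fun T => ∀ᶠ n in atTop, ∀ s ∈ T,
    ∃ z ∈ Cn n, StrongDual.toWeakDual z ∈ W ∧ |s y - z y| < ω) (by simp)
    (fun T T' hT hT' => hT'.mono fun n hn s hs => hn s (hT hs))
    (fun T T' hT hT' => (hT.and hT').mono fun n hn s hs => hs.elim (hn.1 s) (hn.2 s)) ?_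
  intro s hs
  refine ⟨StrongDual.toWeakDual ⁻¹' {q : WeakDual ℝ Y | |s y - q y| < ω / 2},
    mem_nhdsWithin_of_mem_nhds (((hev s _).preimage
      NormedSpace.Dual.toWeakDual_continuous).mem_nhds (by simpa using half_pos hω)), ?_⟩
  filter_upwards [h s (hSC hs) _ (hW.inter (hev s (ω / 2))) ⟨hSW hs, by simpa using half_pos hω⟩]
    with n ⟨z, hz, hzW, hzs⟩ s' hs'
  refine ⟨z, hz, hzW, ?_⟩
  have h1 : |s y - s' y| < ω / 2 := hs'
  have h2 : |s y - z y| < ω / 2 := hzs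
  rw [abs_lt] at *
  constructor <;> linarith

/-- `J` is covered by the `ω`-thickened images of the components that meet `T`. Thickening adds `2 *
ω ≤ ε * ρ` to each diameter, at most `ε` times the length of the component, so the error is relative
and does not depend on the number of components. -/
theorem volume_image_le_of_components {D T : Set (StrongDual ℝ Y)} (hD : IsCompact D)
    (hDfin : Measure.hausdorffMeasure 1 D ≠ ∞) {y : Y} (hy : ‖y‖ ≤ 1) {ω ρ ε : ℝ} (hω : 0 < ω)
    (hρ : 0 < ρ) (hε : 0 ≤ ε) (hωρ : 2 * ω ≤ ε * ρ) (hTD : T ⊆ D)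
    (hbig : ∀ z ∈ T, ENNReal.ofReal ρ ≤ Measure.hausdorffMeasure 1 (connectedComponentIn D z))
    {J : Set ℝ} (hJ : ∀ s ∈ J, ∃ z ∈ T, |s - z y| < ω) :
    volume J ≤ ENNReal.ofReal (1 + ε) * Measure.hausdorffMeasure 1 D := by
  set u : Set (Set (StrongDual ℝ Y)) := connectedComponentIn D '' T with hu
  have hm : ∀ K ∈ u, MeasurableSet K := by
    rintro _ ⟨z, -, rfl⟩
    exact (isCompact_connectedComponentIn hD z).measurableSet
  have hpre : ∀ K ∈ u, IsPreconnected K := by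
    rintro _ ⟨z, -, rfl⟩
    exact isPreconnected_connectedComponentIn
  have hsub : ∀ K ∈ u, K ⊆ D := by
    rintro _ ⟨z, -, rfl⟩
    exact connectedComponentIn_subset D z
  have hge : ∀ K ∈ u, ENNReal.ofReal ρ ≤ Measure.hausdorffMeasure 1 K := by
    rintro _ ⟨z, hz, rfl⟩
    exact hbig z hz
  have hdisj : u.PairwiseDisjoint id := by
    rintro _ ⟨z, -, rfl⟩ _ ⟨z', -, rfl⟩ hne
    refine Set.disjoint_left.2 fun p hp hp' => hne ?_
    exact (connectedComponentIn_eq hp).trans (connectedComponentIn_eq hp').symm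
  have hcount : Countable u := (countable_of_pairwiseDisjoint_of_measure_pos hm hdisj hsub hDfin
    fun K hK h0 => by
      have := hge K hK
      rw [h0, nonpos_iff_eq_zero, ENNReal.ofReal_eq_zero] at this
      linarith).to_subtype
  have hcov : J ⊆ ⋃ K : u, Metric.thickening ω ((fun f : StrongDual ℝ Y => f y) '' K) := by
    intro s hs
    obtain ⟨z, hz, hsz⟩ := hJ s hs
    refine Set.mem_iUnion.2 ⟨⟨_, z, hz, rfl⟩, Metric.mem_thickening_iff.2
      ⟨z y, ⟨z, mem_connectedComponentIn (hTD hz), rfl⟩, hsz⟩⟩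
  have hterm : ∀ K : u, volume (Metric.thickening ω ((fun f : StrongDual ℝ Y => f y) '' K)) ≤
      ENNReal.ofReal (1 + ε) * Measure.hausdorffMeasure 1 (K : Set (StrongDual ℝ Y)) := by
    intro K
    have h1 := Metric.ediam_thickening_le (s := (fun f : StrongDual ℝ Y => f y) '' K)
      (Real.toNNReal ω)
    rw [Real.coe_toNNReal _ hω.le] at h1
    have h2 : Metric.ediam ((fun f : StrongDual ℝ Y => f y) '' K) ≤
        Metric.ediam (K : Set (StrongDual ℝ Y)) := by
      simpa using (lipschitzWith_apply_of_norm_le_one hy).ediam_image_le (K : Set (StrongDual ℝ Y))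
    have h3 : 2 * ENNReal.ofReal ω ≤ ENNReal.ofReal ε *
        Measure.hausdorffMeasure 1 (K : Set (StrongDual ℝ Y)) := by
      refine le_trans ?_ (mul_le_mul_right (hge K K.2) _)
      rw [← ENNReal.ofReal_ofNat, ← ENNReal.ofReal_mul (by norm_num), ← ENNReal.ofReal_mul hε]
      exact ENNReal.ofReal_le_ofReal hωρ
    calc volume _ ≤ Metric.ediam _ := Real.volume_le_diam _
      _ ≤ _ + 2 * ENNReal.ofReal ω := h1
      _ ≤ Measure.hausdorffMeasure 1 (K : Set (StrongDual ℝ Y)) + ENNReal.ofReal ε *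
          Measure.hausdorffMeasure 1 (K : Set (StrongDual ℝ Y)) :=
        add_le_add (h2.trans (hpre K K.2).ediam_le_hausdorffMeasure) h3
      _ = _ := by rw [ENNReal.ofReal_add zero_le_one hε, ENNReal.ofReal_one, add_mul, one_mul]
  calc volume J ≤ ∑' K : u, volume _ := (measure_mono hcov).trans (measure_iUnion_le _)
    _ ≤ ∑' K : u, ENNReal.ofReal (1 + ε) *
        Measure.hausdorffMeasure 1 (K : Set (StrongDual ℝ Y)) := ENNReal.tsum_le_tsum hterm
    _ = ENNReal.ofReal (1 + ε) *
        ∑' K : u, Measure.hausdorffMeasure 1 (K : Set (StrongDual ℝ Y)) := ENNReal.tsum_mul_left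
    _ ≤ _ := by
      gcongr
      exact tsum_measure_le_of_pairwiseDisjoint hm hdisj hsub

end WeakStar

/-! ### Gołąb's theorem in the weak* setting -/

section Golab

variable {Y : Type*} [NormedAddCommGroup Y] [NormedSpace ℝ Y]
  {Cn : ℕ → Set (StrongDual ℝ Y)} {C : Set (StrongDual ℝ Y)}

theorem isCompact_weakStarBall : IsCompact (weakStarBall Y) :=
  WeakDual.isCompact_closedBall (0 : StrongDual ℝ Y) 1

/-- Nest weak* neighbourhoods `W`, `O` and `V` of `S`, with closures inside the next one. A
component of `Cn n` in the closed set `Q` between `O` and `V` that meets `W` must leave `O`, so it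
is at least as long as the norm gap `ρ`, unless all of `Cn n` lies in `O`. -/
theorem WeakStarLowerLimit.eventually_abs_sub_le (h : WeakStarLowerLimit Cn C)
    (hball : ∀ n, Cn n ⊆ Metric.closedBall 0 1) (hcomp : ∀ n, IsCompact (Cn n))
    (hconn : ∀ n, IsPreconnected (Cn n)) (hfin : ∀ n, Measure.hausdorffMeasure 1 (Cn n) ≠ ∞)
    {S : Set (StrongDual ℝ Y)} (hS : IsCompact S) (hSconn : IsPreconnected S) (hSC : S ⊆ C)
    {V : Set (WeakDual ℝ Y)} (hV : IsOpen V) (hSV : S ⊆ StrongDual.toWeakDual ⁻¹' V)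
    {a b : StrongDual ℝ Y} (ha : a ∈ S) (hb : b ∈ S) {y : Y} (hy : ‖y‖ ≤ 1) {ε : ℝ} (hε : 0 < ε) :
    ∀ᶠ n in atTop, ENNReal.ofReal |b y - a y| ≤ ENNReal.ofReal (1 + ε) *
      Measure.hausdorffMeasure 1 (Cn n ∩ StrongDual.toWeakDual ⁻¹' V) + ENNReal.ofReal ε := by
  have hcont := NormedSpace.Dual.toWeakDual_continuous (𝕜 := ℝ) (E := Y)
  have hS' := isCompact_toWeakDual_image hS
  obtain ⟨O, hO, hSO, hOV⟩ := hS'.exists_isOpen_closure_subset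
    (hV.mem_nhdsSet.2 (Set.image_subset_iff.2 hSV))
  obtain ⟨Q, hQ, hOQ, hQV⟩ : ∃ Q : Set (WeakDual ℝ Y), IsClosed Q ∧ O ⊆ Q ∧ Q ⊆ V :=
    ⟨closure O, isClosed_closure, subset_closure, hOV⟩
  obtain ⟨W, hW, hSW, hWO⟩ := hS'.exists_isOpen_closure_subset (hO.mem_nhdsSet.2 hSO)
  obtain ⟨ρ, hρ, hdist⟩ := exists_pos_le_dist_of_disjoint_isCompact
    (isCompact_weakStarBall.inter_left (isClosed_closure (s := W)))
    (isCompact_weakStarBall.diff hO)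
    (Set.disjoint_left.2 fun x hx hx' => hx'.2 (hWO hx.1))
  set ω := min (ε / 2) (ε * ρ / 2) with hω
  have hωpos : 0 < ω := by positivity
  have hω1 : 2 * ω ≤ ε := by linarith [min_le_left (ε / 2) (ε * ρ / 2)]
  have hω2 : 2 * ω ≤ ε * ρ := by linarith [min_le_right (ε / 2) (ε * ρ / 2)]
  filter_upwards [h.eventually_forall_exists_near hS hSC hW (Set.image_subset_iff.1 hSW) y hωpos]
    with n hn
  by_cases hcase : Cn n ⊆ StrongDual.toWeakDual ⁻¹' O
  -- Here no component need be long, but `Cn n` itself is connected and joins points near `a` and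
  -- `b`.
  · have hCV : Cn n ∩ StrongDual.toWeakDual ⁻¹' V = Cn n :=
      Set.inter_eq_left.2 fun x hx => hQV (hOQ (hcase hx))
    obtain ⟨p, hp, -, hpa⟩ := hn a ha
    obtain ⟨q, hq, -, hqb⟩ := hn b hb
    have h1 : |q y - p y| ≤ dist q p := by
      simpa [Real.dist_eq] using (lipschitzWith_apply_of_norm_le_one hy).dist_le_mul q p
    have h2 : |b y - a y| ≤ dist q p + ε := by
      rw [abs_le] at *
      rw [abs_lt] at *
      constructor <;> linarith
    rw [hCV]
    calc ENNReal.ofReal |b y - a y| ≤ ENNReal.ofReal (dist q p + ε) := ENNReal.ofReal_le_ofReal h2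
      _ = edist q p + ENNReal.ofReal ε := by rw [ENNReal.ofReal_add dist_nonneg hε.le, edist_dist]
      _ ≤ Measure.hausdorffMeasure 1 (Cn n) + ENNReal.ofReal ε := by
        gcongr
        exact (Metric.edist_le_ediam_of_mem hq hp).trans (hconn n).ediam_le_hausdorffMeasure
      _ ≤ _ := by
        gcongr
        refine le_mul_of_one_le_left' ?_
        rw [← ENNReal.ofReal_one]
        exact ENNReal.ofReal_le_ofReal (by linarith)
  · set F : Set (StrongDual ℝ Y) := StrongDual.toWeakDual ⁻¹' Q
    have hF : IsClosed F := hQ.preimage hcont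
    have hD : IsCompact (Cn n ∩ F) := (hcomp n).inter_right hF
    have hvol : volume (Set.uIcc (a y) (b y)) ≤
        ENNReal.ofReal (1 + ε) * Measure.hausdorffMeasure 1 (Cn n ∩ F) := by
      refine volume_image_le_of_components (T := Cn n ∩ StrongDual.toWeakDual ⁻¹' W) hD
        (ne_top_of_le_ne_top (hfin n) (measure_mono Set.inter_subset_left)) hy hωpos hρ hε.le hω2
        (fun z hz => ⟨hz.1, hOQ (hWO (subset_closure hz.2))⟩) ?_ ?_
      · intro z hz
        have hzD : z ∈ Cn n ∩ F := ⟨hz.1, hOQ (hWO (subset_closure hz.2))⟩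
        obtain ⟨q, hq, hqO⟩ := Set.not_subset.1 fun hsub => hcase
          (subset_of_connectedComponentIn_subset (hcomp n) (hconn n) hF (hO.preimage hcont)
            (Set.preimage_mono hOQ) hzD hsub)
        have h1 : ρ ≤ dist z q := hdist z q ⟨subset_closure hz.2, hball n hz.1⟩
          ⟨hball n (connectedComponentIn_subset _ _ hq).1, hqO⟩
        calc ENNReal.ofReal ρ ≤ edist z q := by
              rw [edist_dist]; exact ENNReal.ofReal_le_ofReal h1
          _ ≤ _ := Metric.edist_le_ediam_of_mem (mem_connectedComponentIn hzD) hq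
          _ ≤ _ := isPreconnected_connectedComponentIn.ediam_le_hausdorffMeasure
      · intro s hs
        have himg : IsPreconnected ((fun f : StrongDual ℝ Y => f y) '' S) :=
          hSconn.image _ (lipschitzWith_apply_of_norm_le_one hy).continuous.continuousOn
        obtain ⟨f, hf, rfl⟩ := himg.ordConnected.uIcc_subset ⟨a, ha, rfl⟩ ⟨b, hb, rfl⟩ hs
        obtain ⟨z, hz, hzW, hfz⟩ := hn f hf
        exact ⟨z, ⟨hz, hzW⟩, hfz⟩
    rw [Real.volume_interval] at hvol
    refine hvol.trans (le_trans ?_ le_self_add)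
    gcongr
    exact Set.preimage_mono hQV

theorem exists_ediam_le_edist {X : Type*} [PseudoMetricSpace X] {S : Set X} (hS : IsCompact S)
    (hne : S.Nonempty) : ∃ a ∈ S, ∃ b ∈ S, Metric.ediam S ≤ edist b a := by
  obtain ⟨p, hp, hmax⟩ := (hS.prod hS).exists_isMaxOn (hne.prod hne)
    (f := fun p : X × X => edist p.1 p.2) continuous_edist.continuousOn
  exact ⟨p.2, hp.2, p.1, hp.1, Metric.ediam_le fun x hx y hy =>
    hmax (show (x, y) ∈ S ×ˢ S from ⟨hx, hy⟩)⟩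

/-- The dual norm is a supremum over the predual ball, possibly not attained; hence the loss `η`. -/
theorem exists_norm_le_one_dist_le (a b : StrongDual ℝ Y) {η : ℝ} (hη : 0 < η) :
    ∃ y : Y, ‖y‖ ≤ 1 ∧ dist b a ≤ |b y - a y| + η := by
  obtain ⟨y, hy, hlt⟩ := ContinuousLinearMap.exists_lt_apply_of_lt_opNorm (b - a)
    (r := dist b a - η) (by rw [← dist_eq_norm]; linarith)
  refine ⟨y, hy.le, ?_⟩
  rw [sub_apply, Real.norm_eq_abs] at hlt
  linarith

/-- A subcontinuum of the limit bounds from below the length of `Cn n` in each of its weak*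
neighbourhoods, up to a small error. -/
theorem WeakStarLowerLimit.eventually_ediam_le (h : WeakStarLowerLimit Cn C)
    (hball : ∀ n, Cn n ⊆ Metric.closedBall 0 1) (hcomp : ∀ n, IsCompact (Cn n))
    (hconn : ∀ n, IsPreconnected (Cn n)) {L : NNReal}
    (hL : ∀ n, Measure.hausdorffMeasure 1 (Cn n) ≤ L)
    {S : Set (StrongDual ℝ Y)} (hS : IsCompact S) (hSconn : IsConnected S) (hSC : S ⊆ C)
    {V : Set (WeakDual ℝ Y)} (hV : IsOpen V) (hSV : S ⊆ StrongDual.toWeakDual ⁻¹' V)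
    {ε : NNReal} (hε : 0 < ε) :
    ∀ᶠ n in atTop, Metric.ediam S ≤
      Measure.hausdorffMeasure 1 (Cn n ∩ StrongDual.toWeakDual ⁻¹' V) + ε := by
  obtain ⟨a, ha, b, hb, hdiam⟩ := exists_ediam_le_edist hS hSconn.nonempty
  -- The losses are `η * m`, with `m ≤ L`, plus `η` from the choice of `y` and `η` from the
  -- increment estimate.
  set η : ℝ := ε / (L + 2) with hη
  have hηpos : 0 < η := by positivity
  have hηL : η * L + 2 * η = ε := by
    rw [hη]; field_simp
  obtain ⟨y, hy, hyη⟩ := exists_norm_le_one_dist_le a b hηpos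
  filter_upwards [h.eventually_abs_sub_le hball hcomp hconn
    (fun n => ne_top_of_le_ne_top ENNReal.coe_ne_top (hL n)) hS hSconn.isPreconnected hSC hV hSV
    ha hb hy hηpos] with n hn
  set m := Measure.hausdorffMeasure 1 (Cn n ∩ StrongDual.toWeakDual ⁻¹' V)
  have hm : m ≤ L := (measure_mono Set.inter_subset_left).trans (hL n)
  calc Metric.ediam S ≤ edist b a := hdiam
    _ ≤ ENNReal.ofReal (|b y - a y| + η) := by
      rw [edist_dist]; exact ENNReal.ofReal_le_ofReal hyη
    _ = ENNReal.ofReal |b y - a y| + ENNReal.ofReal η := ENNReal.ofReal_add (abs_nonneg _) hηpos.le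
    _ ≤ (ENNReal.ofReal (1 + η) * m + ENNReal.ofReal η) + ENNReal.ofReal η := by gcongr
    _ = m + (ENNReal.ofReal η * m + 2 * ENNReal.ofReal η) := by
      rw [ENNReal.ofReal_add zero_le_one hηpos.le, ENNReal.ofReal_one]; ring
    _ ≤ m + (ENNReal.ofReal η * L + 2 * ENNReal.ofReal η) := by gcongr
    _ = m + ε := by
      rw [← ENNReal.ofReal_coe_nnreal (p := L), ← ENNReal.ofReal_ofNat,
        ← ENNReal.ofReal_mul hηpos.le, ← ENNReal.ofReal_mul (by norm_num),
        ← ENNReal.ofReal_add (by positivity) (by positivity), hηL, ENNReal.ofReal_coe_nnreal]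

theorem exists_pairwiseDisjoint_isOpen_superset {Z : Type*} [TopologicalSpace Z] [T2Space Z]
    {ι : Type*} (v : Finset ι) {K : ι → Set Z} (hK : ∀ i ∈ v, IsCompact (K i))
    (hd : (v : Set ι).PairwiseDisjoint K) :
    ∃ V : ι → Set Z, (∀ i ∈ v, IsOpen (V i) ∧ K i ⊆ V i) ∧ (v : Set ι).PairwiseDisjoint V := by
  classical
  have hsep : ∀ i ∈ v, ∃ P Q : Set Z, IsOpen P ∧ IsOpen Q ∧ K i ⊆ P ∧
      (∀ j ∈ v, j ≠ i → K j ⊆ Q) ∧ Disjoint P Q := by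
    intro i hi
    obtain ⟨P, Q, hP, hQ, hKP, hKQ, hPQ⟩ := SeparatedNhds.of_isCompact_isCompact (hK i hi)
      ((v.erase i).isCompact_biUnion (f := K) fun j hj => hK j (Finset.mem_of_mem_erase hj))
      (Set.disjoint_iUnion₂_right.2 fun j hj => hd hi (Finset.mem_of_mem_erase hj)
        (Finset.ne_of_mem_erase hj).symm)
    exact ⟨P, Q, hP, hQ, hKP, fun j hj hji =>
      (Set.subset_biUnion_of_mem (u := K) (Finset.mem_erase.2 ⟨hji, hj⟩)).trans hKQ, hPQ⟩
  choose! P Q hP hQ hKP hKQ hPQ using hsep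
  refine ⟨fun i => P i ∩ ⋂ j ∈ v.erase i, Q j, fun i hi => ⟨(hP i hi).inter
    (isOpen_biInter_finset fun j hj => hQ j (Finset.mem_of_mem_erase hj)),
    Set.subset_inter (hKP i hi) (Set.subset_iInter₂ fun j hj => hKQ j (Finset.mem_of_mem_erase hj)
      i hi (Finset.ne_of_mem_erase hj).symm)⟩, fun i hi j hj hij => ?_⟩
  exact Set.disjoint_left.2 fun x hx hx' => Set.disjoint_left.1 (hPQ i hi) hx.1
    (Set.mem_iInter₂.1 hx'.2 i (Finset.mem_erase.2 ⟨hij, hi⟩))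

/-- Gołąb's theorem localized to a weak* open set. -/
theorem WeakStarLowerLimit.hausdorffMeasure_inter_le_liminf (h : WeakStarLowerLimit Cn C)
    (hball : ∀ n, Cn n ⊆ Metric.closedBall 0 1) (hcomp : ∀ n, IsCompact (Cn n))
    (hconn : ∀ n, IsPreconnected (Cn n)) {L : NNReal}
    (hL : ∀ n, Measure.hausdorffMeasure 1 (Cn n) ≤ L)
    (hC : IsCompact C) (hCconn : IsPreconnected C) (hCfin : Measure.hausdorffMeasure 1 C ≠ ∞)
    {G : Set (WeakDual ℝ Y)} (hG : IsOpen G) :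
    Measure.hausdorffMeasure 1 (C ∩ StrongDual.toWeakDual ⁻¹' G) ≤
      liminf (fun n => Measure.hausdorffMeasure 1 (Cn n ∩ StrongDual.toWeakDual ⁻¹' G)) atTop := by
  have hcont := NormedSpace.Dual.toWeakDual_continuous (𝕜 := ℝ) (E := Y)
  refine le_of_forall_lt fun c hc => ?_
  obtain ⟨c', hcc', hc'⟩ := exists_between hc
  refine hcc'.trans_le (le_liminf_of_le (by isBoundedDefault) ?_)
  obtain ⟨v, hv, hvd, hsum⟩ := exists_disjoint_continua_lt_sum_ediam hC hCconn hCfin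
    (hG.preimage hcont) hc'
  obtain ⟨η, hη, hηsum⟩ := ENNReal.lt_iff_exists_add_pos_lt.1 hsum
  obtain ⟨V, hV, hVd⟩ := exists_pairwiseDisjoint_isOpen_superset v
    (K := fun S => StrongDual.toWeakDual '' S)
    (fun S hS => isCompact_toWeakDual_image (hv S hS).1)
    (fun S hS T hT hST => (Set.disjoint_image_iff StrongDual.toWeakDual.injective).2
      (hvd hS hT hST))
  -- The slack `η` is shared among the members of `v`; the added 1 keeps the divisor nonzero.
  have hε : 0 < η / (v.card + 1) := by positivity
  have hev : ∀ᶠ n in atTop, ∀ S ∈ v, Metric.ediam S ≤ Measure.hausdorffMeasure 1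
      (Cn n ∩ StrongDual.toWeakDual ⁻¹' (V S ∩ G)) + (η / (v.card + 1) : NNReal) :=
    (Filter.eventually_all_finset v).2 fun S hS => h.eventually_ediam_le hball hcomp hconn hL
      (hv S hS).1 (hv S hS).2.1 ((hv S hS).2.2.trans Set.inter_subset_left)
      ((hV S hS).1.inter hG)
      (fun x hx => ⟨(hV S hS).2 ⟨x, hx, rfl⟩, ((hv S hS).2.2 hx).2⟩) hε
  filter_upwards [hev] with n hn
  have h1 : ∑ S ∈ v, Measure.hausdorffMeasure 1 (Cn n ∩ StrongDual.toWeakDual ⁻¹' (V S ∩ G)) ≤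
      Measure.hausdorffMeasure 1 (Cn n ∩ StrongDual.toWeakDual ⁻¹' G) := by
    rw [← measure_biUnion_finset (fun S hS T hT hST => ?_)
      (fun S hS => (hcomp n).measurableSet.inter (((hV S hS).1.inter hG).preimage
        hcont).measurableSet)]
    · exact measure_mono (Set.iUnion₂_subset fun S hS =>
        Set.inter_subset_inter_right _ (Set.preimage_mono Set.inter_subset_right))
    · exact ((hVd hS hT hST).preimage _).mono (fun x hx => hx.2.1) (fun x hx => hx.2.1)
  have h2 : (v.card : ℝ≥0∞) * (η / (v.card + 1) : NNReal) ≤ η := by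
    have : (v.card : NNReal) * (η / (v.card + 1)) ≤ η := by
      rw [mul_div_assoc', div_le_iff₀ (by positivity), mul_comm]
      gcongr
      simp
    exact_mod_cast this
  have h3 : c' + η ≤ Measure.hausdorffMeasure 1 (Cn n ∩ StrongDual.toWeakDual ⁻¹' G) + η := by
    refine hηsum.le.trans ((Finset.sum_le_sum hn).trans ?_)
    rw [Finset.sum_add_distrib, Finset.sum_const, nsmul_eq_mul]
    exact add_le_add h1 h2
  exact (ENNReal.add_le_add_iff_right ENNReal.coe_ne_top).1 h3

/-- Nothing is known of `w` outside the ball; cutting it off there yields a function that is Borel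
on the whole dual. -/
theorem weightedLength_eq_lintegral_indicator (w : StrongDual ℝ Y → ℝ≥0∞)
    {A : Set (StrongDual ℝ Y)} (hA : IsClosed A) (hball : A ⊆ Metric.closedBall 0 1) :
    weightedLength w A = ∫⁻ x, (Metric.closedBall (0 : StrongDual ℝ Y) 1).indicator w x
      ∂((Measure.hausdorffMeasure 1).restrict A) :=
  setLIntegral_congr_fun hA.measurableSet fun _ hx => (Set.indicator_of_mem (hball hx) w).symm

theorem exists_pos_forall_mul_hausdorffMeasure_le {w : StrongDual ℝ Y → ℝ≥0∞}
    (hw_pos : ∀ x ∈ Metric.closedBall (0 : StrongDual ℝ Y) 1, 0 < w x)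
    (hw_lsc : LowerSemicontinuousOn (fun x : WeakDual ℝ Y => w (WeakDual.toStrongDual x))
      (weakStarBall Y)) :
    ∃ m : ℝ≥0∞, 0 < m ∧ ∀ A : Set (StrongDual ℝ Y), IsClosed A → A ⊆ Metric.closedBall 0 1 →
      m * Measure.hausdorffMeasure 1 A ≤ weightedLength w A := by
  obtain ⟨x₀, hx₀, hmin⟩ := hw_lsc.exists_isMinOn
    ⟨StrongDual.toWeakDual 0, by simp [weakStarBall]⟩ isCompact_weakStarBall
  refine ⟨w (WeakDual.toStrongDual x₀), hw_pos _ hx₀, fun A hA hball => ?_⟩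
  rw [← setLIntegral_const]
  exact setLIntegral_mono' hA.measurableSet fun x hx =>
    hmin (show StrongDual.toWeakDual x ∈ weakStarBall Y from hball hx)

theorem weakStarTrace_nonempty {A : Set (StrongDual ℝ Y)} (hA : A ⊆ Metric.closedBall 0 1)
    (hne : A.Nonempty) : (weakStarTrace A).Nonempty :=
  hne.elim fun x hx => ⟨⟨StrongDual.toWeakDual x, hA hx⟩, hx⟩

theorem isCompact_weakStarTrace {A : Set (StrongDual ℝ Y)} (hA : A ⊆ Metric.closedBall 0 1)
    (hcomp : IsCompact A) : IsCompact (weakStarTrace A) := by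
  rw [Subtype.isCompact_iff]
  convert isCompact_toWeakDual_image hcomp using 1
  ext x
  constructor
  · rintro ⟨z, hz, rfl⟩
    exact ⟨_, hz, rfl⟩
  · rintro ⟨z, hz, rfl⟩
    exact ⟨⟨StrongDual.toWeakDual z, hA hz⟩, hz, rfl⟩

theorem IsWeakStarCompatible.compactSpace {d : MetricSpace (weakStarBall Y)}
    (hd : IsWeakStarCompatible d) :
    @CompactSpace (weakStarBall Y) d.toUniformSpace.toTopologicalSpace :=
  hd ▸ isCompact_iff_compactSpace.1 isCompact_weakStarBall

theorem weakStarLowerLimit_of_tendsto {d : MetricSpace (weakStarBall Y)}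
    (hd : IsWeakStarCompatible d) (hball : ∀ n, Cn n ⊆ Metric.closedBall 0 1)
    (hne : ∀ n, (Cn n).Nonempty) (hC_ball : C ⊆ Metric.closedBall 0 1)
    (hconv : Tendsto (fun n => weakStarHausdorffDist d (Cn n) C) atTop (𝓝 0)) :
    WeakStarLowerLimit Cn C := by
  intro x hx G hG hxG
  have hG' : IsOpen[d.toUniformSpace.toTopologicalSpace]
      (Subtype.val ⁻¹' G : Set (weakStarBall Y)) := hd ▸ hG.preimage continuous_subtype_val
  filter_upwards [@eventually_nonempty_inter_of_tendsto_hausdorffDist (weakStarBall Y)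
    d.toPseudoMetricSpace hd.compactSpace (fun n => weakStarTrace (Cn n)) (weakStarTrace C)
    (fun n => weakStarTrace_nonempty (hball n) (hne n)) hconv _ hG'
    ⟨⟨StrongDual.toWeakDual x, hC_ball hx⟩, hx, hxG⟩] with n ⟨z, hz, hzG⟩
  exact ⟨WeakDual.toStrongDual z, hz, hzG⟩

theorem eventually_subset_of_tendsto {d : MetricSpace (weakStarBall Y)}
    (hd : IsWeakStarCompatible d) (hball : ∀ n, Cn n ⊆ Metric.closedBall 0 1)
    (hne : ∀ n, (Cn n).Nonempty) (hC_ball : C ⊆ Metric.closedBall 0 1) (hCne : C.Nonempty)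
    (hC : IsCompact C)
    (hconv : Tendsto (fun n => weakStarHausdorffDist d (Cn n) C) atTop (𝓝 0))
    {G : Set (WeakDual ℝ Y)} (hG : IsOpen G) (hCG : C ⊆ StrongDual.toWeakDual ⁻¹' G) :
    ∀ᶠ n in atTop, Cn n ⊆ StrongDual.toWeakDual ⁻¹' G := by
  have hG' : IsOpen[d.toUniformSpace.toTopologicalSpace]
      (Subtype.val ⁻¹' G : Set (weakStarBall Y)) := hd ▸ hG.preimage continuous_subtype_val
  have hC' : @IsCompact (weakStarBall Y) d.toUniformSpace.toTopologicalSpace (weakStarTrace C) :=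
    hd ▸ isCompact_weakStarTrace hC_ball hC
  filter_upwards [@eventually_subset_of_tendsto_hausdorffDist (weakStarBall Y)
    d.toPseudoMetricSpace hd.compactSpace (fun n => weakStarTrace (Cn n)) (weakStarTrace C)
    (fun n => weakStarTrace_nonempty (hball n) (hne n)) (weakStarTrace_nonempty hC_ball hCne)
    hconv hC' _ hG' fun z hz => hCG hz] with n hn x hx
  exact @hn ⟨StrongDual.toWeakDual x, hball n hx⟩ hx

end Golab

/-! ### The compactness and semicontinuity theorem -/

theorem mainTheorem2 {Y : Type*} [NormedAddCommGroup Y] [NormedSpace ℝ Y] [CompleteSpace Y]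
    [TopologicalSpace.SeparableSpace Y]
    (d : MetricSpace (weakStarBall Y)) (hd : IsWeakStarCompatible d)
    (Cn : ℕ → Set (StrongDual ℝ Y))
    (hCn_ball : ∀ n, Cn n ⊆ Metric.closedBall 0 1)
    (hCn_nonempty : ∀ n, (Cn n).Nonempty)
    (hCn_compact : ∀ n, IsCompact (Cn n))
    (hCn_connected : ∀ n, IsConnected (Cn n))
    (C : Set (StrongDual ℝ Y))
    (hC_ball : C ⊆ Metric.closedBall 0 1) (hC_nonempty : C.Nonempty) (hC_closed : IsClosed C)
    (hconv : Tendsto (fun n => weakStarHausdorffDist d (Cn n) C) atTop (𝓝 0))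
    (w : StrongDual ℝ Y → ℝ≥0∞)
    (hw_pos : ∀ x ∈ Metric.closedBall (0 : StrongDual ℝ Y) 1, 0 < w x)
    (hw_lsc : LowerSemicontinuousOn (fun x : WeakDual ℝ Y => w (WeakDual.toStrongDual x))
      (weakStarBall Y))
    (hw_bdd : (⨆ n, weightedLength w (Cn n)) < ∞) :
    (IsCompact C ∧ IsConnected C) ∧
      weightedLength w C ≤ liminf (fun n => weightedLength w (Cn n)) atTop ∧
      ∀ F : Set (StrongDual ℝ Y), (∀ n, F ⊆ Cn n) → F ⊆ C := by
  have hcont := NormedSpace.Dual.toWeakDual_continuous (𝕜 := ℝ) (E := Y)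
  have hconn := fun n => (hCn_connected n).isPreconnected
  have hlow := weakStarLowerLimit_of_tendsto hd hCn_ball hCn_nonempty hC_ball hconv
  obtain ⟨L, hL⟩ : ∃ L : NNReal, ∀ n, Measure.hausdorffMeasure 1 (Cn n) ≤ L := by
    obtain ⟨m, hm, hmw⟩ := exists_pos_forall_mul_hausdorffMeasure_le hw_pos hw_lsc
    have hfin : (⨆ n, weightedLength w (Cn n)) / m ≠ ∞ := ENNReal.div_ne_top hw_bdd.ne hm.ne'
    refine ⟨((⨆ n, weightedLength w (Cn n)) / m).toNNReal, fun n => ?_⟩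
    rw [ENNReal.coe_toNNReal hfin, ENNReal.le_div_iff_mul_le (Or.inl hm.ne') (Or.inr hw_bdd.ne),
      mul_comm]
    exact (hmw _ (hCn_compact n).isClosed (hCn_ball n)).trans
      (le_iSup (fun n => weightedLength w (Cn n)) n)
  have hcard := hlow.card_mul_le hCn_compact hconn hL
  have hL2 : 2 * (L : ℝ≥0∞) ≠ ∞ := by finiteness
  have hC : IsCompact C :=
    isCompact_iff_totallyBounded_isComplete.2
      ⟨totallyBounded_of_card_mul_le hL2 hcard, hC_closed.isComplete⟩
  have hCfin : Measure.hausdorffMeasure 1 C ≠ ∞ := hausdorffMeasure_ne_top_of_card_mul_le hL2 hcard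
  have hup := fun (G : Set (WeakDual ℝ Y)) (hG : IsOpen G) =>
    eventually_subset_of_tendsto hd hCn_ball hCn_nonempty hC_ball hC_nonempty hC hconv hG
  have hCconn : IsPreconnected C := isPreconnected_of_eventually_subset hlow hC hconn hup
  refine ⟨⟨hC, hC_nonempty, hCconn⟩, ?_, fun F hF x hx => ?_⟩
  -- Superlevel sets of the cut-off weight are traces of weak* open sets, where the localized Gołąb
  -- theorem applies.
  · have hlevel : ∀ t : ℝ≥0∞, ∃ G : Set (WeakDual ℝ Y), IsOpen G ∧
        {x | t < (Metric.closedBall (0 : StrongDual ℝ Y) 1).indicator w x} =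
          Metric.closedBall 0 1 ∩ StrongDual.toWeakDual ⁻¹' G := by
      intro t
      obtain ⟨G, hG, hGt⟩ := lowerSemicontinuousOn_iff_preimage_Ioi.1 hw_lsc t
      refine ⟨G, hG, ?_⟩
      ext x
      have hx : x ∈ Metric.closedBall (0 : StrongDual ℝ Y) 1 ∧ t < w x ↔
          x ∈ Metric.closedBall (0 : StrongDual ℝ Y) 1 ∧ StrongDual.toWeakDual x ∈ G :=
        Set.ext_iff.1 hGt (StrongDual.toWeakDual x)
      by_cases hxb : x ∈ Metric.closedBall (0 : StrongDual ℝ Y) 1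
      · simpa [hxb] using hx
      · simp [hxb]
    have hmeas : Measurable ((Metric.closedBall (0 : StrongDual ℝ Y) 1).indicator w) := by
      refine measurable_of_Ioi fun t => ?_
      obtain ⟨G, hG, hGt⟩ := hlevel t
      change MeasurableSet {x | t < (Metric.closedBall (0 : StrongDual ℝ Y) 1).indicator w x}
      rw [hGt]
      exact Metric.isClosed_closedBall.measurableSet.inter (hG.preimage hcont).measurableSet
    rw [weightedLength_eq_lintegral_indicator w hC_closed hC_ball]
    simp only [fun n => weightedLength_eq_lintegral_indicator w (hCn_compact n).isClosed
      (hCn_ball n)]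
    refine lintegral_le_liminf_lintegral_of_measure_lt_le hmeas fun t => ?_
    obtain ⟨G, hG, hGt⟩ := hlevel t
    have hrestrict : ∀ A : Set (StrongDual ℝ Y), IsClosed A → A ⊆ Metric.closedBall 0 1 →
        (Measure.hausdorffMeasure 1).restrict A
          {x | t < (Metric.closedBall (0 : StrongDual ℝ Y) 1).indicator w x} =
        Measure.hausdorffMeasure 1 (A ∩ StrongDual.toWeakDual ⁻¹' G) := by
      intro A hA hball
      rw [Measure.restrict_apply' hA.measurableSet, hGt, Set.inter_comm, ← Set.inter_assoc,
        Set.inter_eq_left.2 hball]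
    rw [hrestrict C hC_closed hC_ball]
    simp only [fun n => hrestrict (Cn n) (hCn_compact n).isClosed (hCn_ball n)]
    exact hlow.hausdorffMeasure_inter_le_liminf hCn_ball hCn_compact hconn hL hC hCconn hCfin hG
  · by_contra hxC
    -- If `x` is not in `C`, the complement of `x` is a weak* open set around `C`, so some `Cn n`
    -- misses `x`.
    obtain ⟨n, hn⟩ := (hup {StrongDual.toWeakDual x}ᶜ isOpen_compl_singleton
      fun z hz hzx => hxC (StrongDual.toWeakDual.injective hzx ▸ hz)).exists
    exact hn (hF n hx) rfl
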